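/- Let $d\in\mathbb N$ and let $p=(p_1,\dots,p_d)$ be a vector of real polynomials in $d$ variables. Write $\deg p=\max_i\deg p_i$, let $\Sigma p=\max_i\sum_\alpha|a_{i,\alpha}|$ where $a_{i,\alpha}$ are the coefficients of $p_i$, and let $\|\cdot\|$ be the maximum norm on $\mathbb R^d$. Let $\mathrm{ComputeTaylor}$ be any subroutine which, on input $p$, $z_0\in\mathbb R^d$, $\omega\in\mathbb N$, $\mu\in(0,1]$ and $s\in\mathbb R$, returns a vector $x$ with $\bigl\|x-\sum_{j<\omega}\frac{z^{(j)}(0)}{j!}s^j\bigr\|\le\mu$, where $z$ is the local solution of $z'=p(z)$, $z(0)=z_0$. Consider the following algorithm $\mathrm{SolvePIVPVariable}(t_0,y_0,p,t,\varepsilon,I)$ over the real numbers, where $t_0,t\in\mathbb R$, $y_0\in\mathbb R^d$, $\varepsilon>0$ and $I>0$. Set $$k=\max(2,\deg p),\quad \bar\varepsilon=\min\left(\varepsilon,\tfrac1{4k}\right),\quad \lambda=1-\frac{k}{1-2k\bar\varepsilon+k},\quad N=1+\frac{2I}{\lambda},\quad \eta=\bar\varepsilon e^{-I},\quad \mu=\frac{\eta}{3N},$$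 and $u=t_0$, $\tilde y=y_0$, $i=0$. While $u<t$, do the following. 1. If $i\ge N$, stop and return $\bot$. 2. Set $\delta=\min\left(t-u,\ \frac{\lambda}{k\,\Sigma p\,\max(1,\|\tilde y\|)^{k-1}}\right)$ (the quotient being $+\infty$ if $\Sigma p=0$), $\ \beta=k\,\Sigma p\,\max(1,\|\tilde y\|)^{k-1}\delta$ and $\omega=\left\lceil-\log_2\frac{\eta}{6N\max(1,\|\tilde y\|)}\right\rceil$. 3. Replace $\tilde y$ by $\mathrm{ComputeTaylor}(p,\tilde y,\omega,\mu,\delta)$, then $u$ by $u+\delta$ and $i$ by $i+1$. 4. If $I<3((i-1)\lambda+\beta)$, stop and return $\bot$. When the loop ends with $u\ge t$, return $\tilde y$. The number of steps is the final value of $i$. Then the number of steps is at most $1+\frac{2I}{\lambda}$, whatever the inputs. Moreover, suppose that $t_0\le t$ and that $y:[t_0,t]\to\mathbb R^d$ satisfies $y(t_0)=y_0$ and $y'(s)=p(y(s))$ for all $s\in[t_0,t]$, and let $x=\mathrm{SolvePIVPVariable}(t_0,y_0,p,t,\varepsilon,I)$. Then * either $x=\bot$ or $\|x-y(t)\|\le\varepsilon$;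 * if $I\ge 6\int_{t_0}^{t}k\,\Sigma p\,\max(1,\bar\varepsilon+\|y(u)\|)^{k-1}\,du$, then $x\ne\bot$. -/

import Mathlib

noncomputable section

namespace PIVP

/-- A vector of `d` real polynomials in `d` variables. -/
abbrev PolyVec (d : ℕ) : Type := Fin d → MvPolynomial (Fin d) ℝ

variable {d : ℕ}

/-- The value `p(x)`. -/
def evalVec (p : PolyVec d) (x : Fin d → ℝ) : Fin d → ℝ :=
  fun i => MvPolynomial.eval x (p i)

/-- The degree `deg p = max_i deg p_i`, as a total degree. -/
def degVec (p : PolyVec d) : ℕ :=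
  Finset.univ.sup fun i => (p i).totalDegree

/-- `Σp = max_i ∑_α |a_{i,α}|`, the largest sum of absolute values of the coefficients
(it is `0` for `d = 0`). -/
def sigmaVec (p : PolyVec d) : ℝ :=
  ⨆ i, ∑ α ∈ (p i).support, |MvPolynomial.coeff α (p i)|

/-- The truncated Taylor series `∑_{k<n} f^(k)(a)/k! (t-a)^k` of `f` at `a`. -/
def taylorSum (f : ℝ → Fin d → ℝ) (a : ℝ) (n : ℕ) (t : ℝ) : Fin d → ℝ :=
  ∑ k ∈ Finset.range n, ((t - a) ^ k / (k.factorial : ℝ)) • iteratedDeriv k f a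

/-- `y' = p(y)` on `[t₀, t]` and `y(t₀) = y₀` (one-sided derivatives at the end points). -/
structure IsSolutionOn (p : PolyVec d) (t₀ : ℝ) (y₀ : Fin d → ℝ) (t : ℝ)
    (y : ℝ → Fin d → ℝ) : Prop where
  initial : y t₀ = y₀
  deriv : ∀ s ∈ Set.Icc t₀ t, HasDerivWithinAt y (evalVec p (y s)) (Set.Icc t₀ t) s

/-- The specification of the Taylor subroutine: on input `p`, `z₀`, an order `ω`, an accuracy
`μ ∈ (0, 1]` and a time step `s`, it returns a vector within `μ`, in the maximum norm, of the
Taylor sum of order `ω`, evaluated at `s`, of the local solution `z` of `z' = p(z)`,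
`z(0) = z₀`. -/
def IsComputeTaylor
    (computeTaylor : PolyVec d → (Fin d → ℝ) → ℕ → ℝ → ℝ → (Fin d → ℝ)) : Prop :=
  ∀ (p : PolyVec d) (z₀ : Fin d → ℝ) (ω : ℕ) (μ s : ℝ), 0 < μ → μ ≤ 1 →
    ∀ z : ℝ → Fin d → ℝ, z 0 = z₀ →
      (∀ᶠ r in nhds (0 : ℝ), HasDerivAt z (evalVec p (z r)) r) →
        ‖computeTaylor p z₀ ω μ s - taylorSum z 0 ω s‖ ≤ μ

/-- `Int(t₀, t) = ∫_{t₀}^t k Σp max(1, ε + ‖y(u)‖)^(k-1) du`. -/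
def pivpInt (p : PolyVec d) (k : ℕ) (ε : ℝ) (y : ℝ → Fin d → ℝ) (t₀ t : ℝ) : ℝ :=
  ∫ u in t₀..t, (k : ℝ) * sigmaVec p * max 1 (ε + ‖y u‖) ^ (k - 1)

/-- `k := max(2, deg p)`. -/
def algK (p : PolyVec d) : ℕ := max 2 (degVec p)

/-- `ε := min(ε, 1/(4k))`. -/
def algEps (p : PolyVec d) (ε : ℝ) : ℝ := min ε (1 / (4 * (algK p : ℝ)))

/-- `λ := 1 - k / (1 - 2kε + k)`, for the reduced accuracy `ε`. -/
def algLam (p : PolyVec d) (ε : ℝ) : ℝ :=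
  1 - (algK p : ℝ) / (1 - 2 * (algK p : ℝ) * algEps p ε + (algK p : ℝ))

/-- The time step `min(t - u, λ / (k Σp max(1, ‖y‖)^(k-1)))`. The quotient is read as `+∞` when
its denominator vanishes, which happens only for `Σp = 0`. -/
def timeStep (p : PolyVec d) (k : ℕ) (lam t u : ℝ) (y : Fin d → ℝ) : ℝ :=
  if sigmaVec p = 0 then t - u
  else min (t - u) (lam / ((k : ℝ) * sigmaVec p * max 1 ‖y‖ ^ (k - 1)))

open Classical in
/-- The `while` loop of the adaptive Taylor algorithm, started with the values `u`, `y`, `i` of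
its variables. It returns the output (`none` stands for `⊥`) together with the final value of
`i`, which is the number of time steps that were carried out. -/
def loop (computeTaylor : PolyVec d → (Fin d → ℝ) → ℕ → ℝ → ℝ → (Fin d → ℝ))
    (p : PolyVec d) (t : ℝ) (k : ℕ) (lam N η μ I : ℝ)
    (u : ℝ) (y : Fin d → ℝ) (i : ℕ) : Option (Fin d → ℝ) × ℕ :=
  if u < t then
    if N ≤ (i : ℝ) then (none, i)
    else
      let δ : ℝ := timeStep p k lam t u y
      let β : ℝ := (k : ℝ) * sigmaVec p * max 1 ‖y‖ ^ (k - 1) * δ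
      let ω : ℕ := ⌈-Real.logb 2 (η / (6 * N * max 1 ‖y‖))⌉₊
      let y' : Fin d → ℝ := computeTaylor p y ω μ δ
      let u' : ℝ := u + δ
      let i' : ℕ := i + 1
      if I < 3 * (((i' : ℝ) - 1) * lam + β) then (none, i')
      else loop computeTaylor p t k lam N η μ I u' y' i'
  else (some y, i)
termination_by ⌈N⌉₊ - i
decreasing_by
  have h : i < ⌈N⌉₊ := Nat.lt_ceil.mpr (not_le.mp (by assumption))
  omega

/-- The adaptive Taylor algorithm: its output (`none` stands for `⊥`) and its number of time
steps. -/
def solveRun (computeTaylor : PolyVec d → (Fin d → ℝ) → ℕ → ℝ → ℝ → (Fin d → ℝ))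
    (t₀ : ℝ) (y₀ : Fin d → ℝ) (p : PolyVec d) (t ε I : ℝ) : Option (Fin d → ℝ) × ℕ :=
  let k : ℕ := algK p
  let ε' : ℝ := algEps p ε
  let lam : ℝ := algLam p ε
  let N : ℝ := 1 + 2 * I / lam
  let η : ℝ := ε' * Real.exp (-I)
  let μ : ℝ := η / (3 * N)
  loop computeTaylor p t k lam N η μ I t₀ y₀ 0

/-- The output of the adaptive Taylor algorithm; `none` stands for `⊥`. -/
def solvePIVPVariable (computeTaylor : PolyVec d → (Fin d → ℝ) → ℕ → ℝ → ℝ → (Fin d → ℝ))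
    (t₀ : ℝ) (y₀ : Fin d → ℝ) (p : PolyVec d) (t ε I : ℝ) : Option (Fin d → ℝ) :=
  (solveRun computeTaylor t₀ y₀ p t ε I).1

/-- The number of time steps that the adaptive Taylor algorithm carries out. -/
def solveSteps (computeTaylor : PolyVec d → (Fin d → ℝ) → ℕ → ℝ → ℝ → (Fin d → ℝ))
    (t₀ : ℝ) (y₀ : Fin d → ℝ) (p : PolyVec d) (t ε I : ℝ) : ℕ :=
  (solveRun computeTaylor t₀ y₀ p t ε I).2

end PIVP

end

/-!
Write `k = max 2 (deg p)`, `σ = Σp` and, for the approximation `x` at the start of a time step of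
length `δ`, `m = max 1 ‖x‖` and `β = k σ m^(k-1) δ`. The choice of `δ` gives
`β ≤ λ < 1/(k+1)`, with equality `β = λ` in every step but the last.

*One step.* On the ball of radius `(1 + 1/k) m` the speed is at most `σ ((1 + 1/k) m)^k`, and since
`(1 + 1/k)^k ≤ 3 (k + 1) / 4`, the displacement during the step is less than `3 m / (4 k)`. So
neither the true solution, which starts within `1/(4k)` of `x`, nor the solution `z` through `x`
leaves this ball (`norm_solution_le`); in particular `z` exists during the step
(`exists_solution`). Four estimates follow.
* The vector field has the Lipschitz constant `k σ ((1 + 1/k) m)^(k-1) ≤ 3 k σ m^(k-1)` on the ball,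
  so by Grönwall's inequality the error is multiplied by at most `exp (3 β)`
  (`norm_solution_sub_le`).
* The derivatives of `z` are polynomials in `z`, namely iterated Lie derivatives of the
  coordinates. A Lie derivative multiplies the `ℓ¹` norm of the coefficients by at most the degree
  times `σ` (`coeffSum_lieDeriv_le`), whence `‖z⁽ⁿ⁾‖ ≤ n! ((k-1) σ)ⁿ R^(1 + n(k-1))` where
  `‖z‖ ≤ R`, and the Taylor remainder of order `n` is at most `2 m / 2ⁿ`
  (`norm_sub_taylorSum_le`).
* By the choice of `ω` and `μ`, a step therefore adds an error of at most `2 η / (3 N)`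
  (`norm_computeTaylor_sub_le`).
* The displacement is even at most `3 m / (k (k + 1))`, and Bernoulli's inequality shows that the
  integrand `k σ max(1, ε + ‖y‖)^(k-1)` stays above half of `k σ m^(k-1)`, so that `β` is at most
  twice the integral over the step (`le_two_mul_integral`).

*The loop.* While it goes on, `i λ + β` is the sum `B` of all the values `β`, and the test for `⊥`
compares `3 B` with `I`. If the test never stops the loop, then `3 B ≤ I` bounds the number of
steps by `1 + I / (3 λ)`, less than `N`, and the final error is at most
`N · 2 η / (3 N) · exp I`, which is below the accuracy. If `I` is at least six times the integral,
then `3 B` never exceeds `I`, because `B` is at most twice the integral.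
-/

noncomputable section

namespace PIVP

variable {d : ℕ}

section

open MvPolynomial

/-! ### Polynomial vector fields and their Lie derivatives -/

/-- The `ℓ¹` norm of the coefficients of a polynomial. -/
def coeffSum (Q : MvPolynomial (Fin d) ℝ) : ℝ := ∑ α ∈ Q.support, |coeff α Q|

lemma coeffSum_eq_of_subset {Q : MvPolynomial (Fin d) ℝ} {s : Finset (Fin d →₀ ℕ)}
    (h : Q.support ⊆ s) : coeffSum Q = ∑ α ∈ s, |coeff α Q| :=
  Finset.sum_subset h fun α _ hα => by simp [notMem_support_iff.1 hα]

lemma coeffSum_nonneg (Q : MvPolynomial (Fin d) ℝ) : 0 ≤ coeffSum Q :=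
  Finset.sum_nonneg fun _ _ => abs_nonneg _

lemma coeffSum_add_le (P Q : MvPolynomial (Fin d) ℝ) :
    coeffSum (P + Q) ≤ coeffSum P + coeffSum Q := by
  classical
  rw [coeffSum_eq_of_subset (s := P.support ∪ Q.support) support_add,
    coeffSum_eq_of_subset (s := P.support ∪ Q.support) Finset.subset_union_left,
    coeffSum_eq_of_subset (Q := Q) (s := P.support ∪ Q.support) Finset.subset_union_right,
    ← Finset.sum_add_distrib]
  exact Finset.sum_le_sum fun α _ => by rw [coeff_add]; exact abs_add_le _ _

lemma coeffSum_sum_le {ι : Type*} (s : Finset ι) (f : ι → MvPolynomial (Fin d) ℝ) :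
    coeffSum (∑ i ∈ s, f i) ≤ ∑ i ∈ s, coeffSum (f i) := by
  classical
  induction s using Finset.induction_on with
  | empty => simp [coeffSum]
  | insert a s ha ih =>
    rw [Finset.sum_insert ha, Finset.sum_insert ha]
    linarith [coeffSum_add_le (f a) (∑ i ∈ s, f i)]

lemma coeffSum_monomial_le (α : Fin d →₀ ℕ) (c : ℝ) : coeffSum (monomial α c) ≤ |c| := by
  classical
  rw [coeffSum_eq_of_subset (s := {α}) support_monomial_subset]
  simp

lemma coeffSum_C_le (c : ℝ) : coeffSum (C c : MvPolynomial (Fin d) ℝ) ≤ |c| :=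
  coeffSum_monomial_le 0 c

lemma coeffSum_monomial_mul_le (α : Fin d →₀ ℕ) (c : ℝ) (Q : MvPolynomial (Fin d) ℝ) :
    coeffSum (monomial α c * Q) ≤ |c| * coeffSum Q := by
  conv_lhs => rw [Q.as_sum, Finset.mul_sum]
  refine (coeffSum_sum_le _ _).trans ?_
  rw [coeffSum, Finset.mul_sum]
  refine Finset.sum_le_sum fun γ _ => ?_
  rw [monomial_mul, ← abs_mul]
  exact coeffSum_monomial_le _ _

lemma degree_le_of_mem_support {Q : MvPolynomial (Fin d) ℝ} {D : ℕ} (hQ : Q.totalDegree ≤ D)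
    {α : Fin d →₀ ℕ} (hα : α ∈ Q.support) : α.degree ≤ D :=
  (le_totalDegree hα).trans hQ

lemma abs_eval_le {Q : MvPolynomial (Fin d) ℝ} {D : ℕ} (hQ : Q.totalDegree ≤ D)
    {x : Fin d → ℝ} {R : ℝ} (hR : 1 ≤ R) (hx : ‖x‖ ≤ R) :
    |eval x Q| ≤ coeffSum Q * R ^ D := by
  rw [eval_eq', coeffSum, Finset.sum_mul]
  refine (Finset.abs_sum_le_sum_abs _ _).trans (Finset.sum_le_sum fun α hα => ?_)
  rw [abs_mul, Finset.abs_prod]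
  gcongr
  calc ∏ i, |x i ^ α i| ≤ ∏ i, R ^ α i := by
        refine Finset.prod_le_prod (fun _ _ => abs_nonneg _) fun i _ => ?_
        rw [abs_pow]
        gcongr
        exact (norm_le_pi_norm x i).trans hx
    _ = R ^ α.degree := by rw [Finset.prod_pow_eq_pow_sum, Finsupp.degree_eq_sum]
    _ ≤ R ^ D := pow_le_pow_right₀ hR (degree_le_of_mem_support hQ hα)

/-- The derivative `∑ⱼ ∂ⱼQ · fⱼ` of the polynomial `Q` along the polynomial vector field `f`. -/
def lieDeriv (f : PolyVec d) (Q : MvPolynomial (Fin d) ℝ) : MvPolynomial (Fin d) ℝ :=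
  ∑ j, pderiv j Q * f j

lemma totalDegree_pderiv_le {Q : MvPolynomial (Fin d) ℝ} {D : ℕ} (hQ : Q.totalDegree ≤ D + 1)
    (j : Fin d) : (pderiv j Q).totalDegree ≤ D := by
  refine Finset.sup_le fun α hα => ?_
  rw [mem_support_iff, coeff_pderiv] at hα
  have h := degree_le_of_mem_support hQ (mem_support_iff.2 (left_ne_zero_of_mul hα))
  rw [map_add, Finsupp.degree_single] at h
  exact Nat.le_of_succ_le_succ h

lemma totalDegree_lieDeriv_le {f : PolyVec d} {Q : MvPolynomial (Fin d) ℝ} {D k : ℕ}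
    (hQ : Q.totalDegree ≤ D + 1) (hf : ∀ j, (f j).totalDegree ≤ k) :
    (lieDeriv f Q).totalDegree ≤ D + k :=
  totalDegree_finsetSum_le fun j _ =>
    (totalDegree_mul _ _).trans (add_le_add (totalDegree_pderiv_le hQ j) (hf j))

lemma coeffSum_lieDeriv_le {f : PolyVec d} {Q : MvPolynomial (Fin d) ℝ} {D : ℕ} {σ : ℝ}
    (hQ : Q.totalDegree ≤ D) (hσ : 0 ≤ σ) (hf : ∀ j, coeffSum (f j) ≤ σ) :
    coeffSum (lieDeriv f Q) ≤ D * coeffSum Q * σ := by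
  have key : lieDeriv f Q = ∑ α ∈ Q.support, ∑ j,
      monomial (α - Finsupp.single j 1) (coeff α Q * α j) * f j := by
    rw [Finset.sum_comm, lieDeriv]
    refine Finset.sum_congr rfl fun j _ => ?_
    conv_lhs => rw [Q.as_sum, map_sum, Finset.sum_mul]
    simp only [pderiv_monomial]
  rw [key, coeffSum.eq_1 Q, Finset.mul_sum, Finset.sum_mul]
  refine (coeffSum_sum_le _ _).trans (Finset.sum_le_sum fun α hα => ?_)
  calc _ ≤ ∑ j, |coeff α Q| * (α j : ℝ) * σ := by
        refine (coeffSum_sum_le _ _).trans (Finset.sum_le_sum fun j _ => ?_)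
        refine (coeffSum_monomial_mul_le _ _ _).trans ?_
        rw [abs_mul, Nat.abs_cast]
        gcongr
        exact hf j
    _ = (α.degree : ℝ) * |coeff α Q| * σ := by
        rw [← Finset.sum_mul, ← Finset.mul_sum, Finsupp.degree_eq_sum]
        push_cast
        ring
    _ ≤ _ := by
        gcongr
        exact degree_le_of_mem_support hQ hα

lemma hasDerivWithinAt_eval {f : PolyVec d} (Q : MvPolynomial (Fin d) ℝ) {z : ℝ → Fin d → ℝ}
    {s : Set ℝ} {r : ℝ} (hz : HasDerivWithinAt z (evalVec f (z r)) s r) :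
    HasDerivWithinAt (fun r => eval (z r) Q) (eval (z r) (lieDeriv f Q)) s r := by
  classical
  induction Q using MvPolynomial.induction_on with
  | C a => simpa [lieDeriv] using hasDerivWithinAt_const r s a
  | add P Q hP hQ =>
    simpa [lieDeriv, add_mul, Finset.sum_add_distrib] using hP.fun_add hQ
  | mul_X P i hP =>
    have hi : HasDerivWithinAt (fun r => z r i) (eval (z r) (f i)) s r :=
      hasDerivWithinAt_pi.1 hz i
    convert! hP.fun_mul hi using 1
    · simp
    · have : lieDeriv f (P * X i) = lieDeriv f P * X i + P * f i := by
        simp only [lieDeriv, pderiv_mul, add_mul, Finset.sum_add_distrib, Finset.sum_mul]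
        congr 1
        · exact Finset.sum_congr rfl fun j _ => by ring
        · rw [Finset.sum_eq_single i] <;> simp +contextual [eq_comm]
      rw [this]
      simp

lemma coeffSum_le_sigmaVec (p : PolyVec d) (i : Fin d) : coeffSum (p i) ≤ sigmaVec p :=
  le_ciSup (f := fun i => coeffSum (p i)) (Set.finite_range _).bddAbove i

lemma sigmaVec_nonneg (p : PolyVec d) : 0 ≤ sigmaVec p :=
  Real.iSup_nonneg fun i => coeffSum_nonneg (p i)

lemma totalDegree_le_degVec (p : PolyVec d) (i : Fin d) : (p i).totalDegree ≤ degVec p :=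
  Finset.le_sup (f := fun i => (p i).totalDegree) (Finset.mem_univ i)

lemma norm_evalVec_le {p : PolyVec d} {k : ℕ} (hk : degVec p ≤ k) {x : Fin d → ℝ} {R : ℝ}
    (hR : 1 ≤ R) (hx : ‖x‖ ≤ R) : ‖evalVec p x‖ ≤ sigmaVec p * R ^ k := by
  have hR0 : 0 ≤ R := by linarith
  refine (pi_norm_le_iff_of_nonneg (mul_nonneg (sigmaVec_nonneg p) (by positivity))).2 fun i => ?_
  refine (abs_eval_le ((totalDegree_le_degVec p i).trans hk) hR hx).trans ?_
  gcongr
  exact coeffSum_le_sigmaVec p i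

/-- A polynomial vector field is Lipschitz on balls. The estimate is the one for the derivative
of a component along the constant vector field `x' - x`. -/
lemma norm_evalVec_sub_le {p : PolyVec d} {k : ℕ} (hk1 : 1 ≤ k) (hk : degVec p ≤ k)
    {x x' : Fin d → ℝ} {R : ℝ} (hR : 1 ≤ R) (hx : ‖x‖ ≤ R) (hx' : ‖x'‖ ≤ R) :
    ‖evalVec p x' - evalVec p x‖ ≤ k * sigmaVec p * R ^ (k - 1) * ‖x' - x‖ := by
  have hσ := sigmaVec_nonneg p
  have hR0 : 0 ≤ R := by linarith
  refine (pi_norm_le_iff_of_nonneg (by positivity)).2 fun i => ?_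
  -- the segment from `x` to `x'` is a solution for the constant field `f`
  let f : PolyVec d := fun j => C ((x' - x) j)
  let z : ℝ → Fin d → ℝ := fun r => x + r • (x' - x)
  have hz : ∀ r, HasDerivWithinAt z (evalVec f (z r)) (Set.Icc 0 1) r := fun r => by
    have h : evalVec f (z r) = x' - x := by ext j; simp [evalVec, f]
    rw [h]
    simpa [z] using (((hasDerivAt_id r).smul_const (x' - x)).const_add x).hasDerivWithinAt
  have hzR : ∀ r ∈ Set.Icc (0 : ℝ) 1, ‖z r‖ ≤ R := fun r hr => by
    have := (convex_closedBall (0 : Fin d → ℝ) R).add_smul_sub_mem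
      (mem_closedBall_zero_iff.2 hx) (mem_closedBall_zero_iff.2 hx') hr
    simpa using this
  have hdeg : (p i).totalDegree ≤ (k - 1) + 1 := by
    have := totalDegree_le_degVec p i; omega
  have hbd : ∀ r ∈ Set.Icc (0 : ℝ) 1,
      ‖eval (z r) (lieDeriv f (p i))‖ ≤ k * sigmaVec p * R ^ (k - 1) * ‖x' - x‖ := fun r hr => by
    have h1 := abs_eval_le (totalDegree_lieDeriv_le (f := f) (k := 0) hdeg
      fun j => (totalDegree_C _).le) hR (hzR r hr)
    have h2 := coeffSum_lieDeriv_le (f := f) (σ := ‖x' - x‖)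
      ((totalDegree_le_degVec p i).trans hk) (norm_nonneg _)
      fun j => (coeffSum_C_le _).trans (norm_le_pi_norm (x' - x) j)
    have h3 := coeffSum_le_sigmaVec p i
    calc _ ≤ coeffSum (lieDeriv f (p i)) * R ^ (k - 1) := h1
      _ ≤ k * sigmaVec p * ‖x' - x‖ * R ^ (k - 1) := by
        gcongr
        exact h2.trans (by gcongr)
      _ = _ := by ring
  have := (convex_Icc (0 : ℝ) 1).norm_image_sub_le_of_norm_hasDerivWithin_le
    (fun r _ => hasDerivWithinAt_eval (p i) (hz r)) hbd
    (Set.left_mem_Icc.2 zero_le_one) (Set.right_mem_Icc.2 zero_le_one)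
  simpa [z, evalVec] using this

open Set Filter Topology

lemma hasDerivWithinAt_evalVec {f : PolyVec d} (q : PolyVec d) {z : ℝ → Fin d → ℝ}
    {s : Set ℝ} {r : ℝ} (hz : HasDerivWithinAt z (evalVec f (z r)) s r) :
    HasDerivWithinAt (fun r => evalVec q (z r)) (evalVec (fun i => lieDeriv f (q i)) (z r)) s r :=
  hasDerivWithinAt_pi.2 fun i => hasDerivWithinAt_eval (q i) hz

/-- The polynomials `qₙ` with `z⁽ⁿ⁾ = qₙ(z)` for every solution `z` of `z' = p(z)`. -/
def lieIter (p : PolyVec d) : ℕ → PolyVec d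
  | 0 => X
  | n + 1 => fun i => lieDeriv p (lieIter p n i)

lemma evalVec_X (x : Fin d → ℝ) : evalVec (X : PolyVec d) x = x := by
  ext i
  simp [evalVec]

lemma totalDegree_lieIter_le {p : PolyVec d} {a : ℕ} (hp : degVec p ≤ a + 1) (n : ℕ) (i : Fin d) :
    (lieIter p n i).totalDegree ≤ n * a + 1 := by
  induction n generalizing i with
  | zero => simp [lieIter]
  | succ n ih =>
    refine (totalDegree_lieDeriv_le (ih i)
      fun j => (totalDegree_le_degVec p j).trans hp).trans_eq ?_
    ring

lemma coeffSum_lieIter_le {p : PolyVec d} {a : ℕ} (ha : 1 ≤ a) (hp : degVec p ≤ a + 1)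
    (n : ℕ) (i : Fin d) :
    coeffSum (lieIter p n i) ≤ n.factorial * (a * sigmaVec p) ^ n := by
  have hσ := sigmaVec_nonneg p
  induction n generalizing i with
  | zero => simpa [lieIter, X] using coeffSum_monomial_le (Finsupp.single i 1) (1 : ℝ)
  | succ n ih =>
    have ha' : (1 : ℝ) ≤ a := by exact_mod_cast ha
    calc _ ≤ ((n * a + 1 : ℕ) : ℝ) * coeffSum (lieIter p n i) * sigmaVec p :=
          coeffSum_lieDeriv_le (totalDegree_lieIter_le hp n i) hσ (coeffSum_le_sigmaVec p)
      _ ≤ ((n + 1) * a) * (n.factorial * (a * sigmaVec p) ^ n) * sigmaVec p := by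
          have h0 := coeffSum_nonneg (lieIter p n i)
          gcongr ?_ * ?_ * _
          · push_cast; linarith
          · exact ih i
      _ = _ := by rw [Nat.factorial_succ]; push_cast; ring

lemma norm_evalVec_lieIter_le {p : PolyVec d} {a : ℕ} (ha : 1 ≤ a) (hp : degVec p ≤ a + 1)
    (n : ℕ) {x : Fin d → ℝ} {R : ℝ} (hR : 1 ≤ R) (hx : ‖x‖ ≤ R) :
    ‖evalVec (lieIter p n) x‖ ≤ n.factorial * (a * sigmaVec p) ^ n * R ^ (n * a + 1) := by
  have hσ := sigmaVec_nonneg p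
  have hR0 : 0 ≤ R := by linarith
  refine (pi_norm_le_iff_of_nonneg (by positivity)).2 fun i => ?_
  refine (abs_eval_le (totalDegree_lieIter_le hp n i) hR hx).trans ?_
  gcongr
  exact coeffSum_lieIter_le ha hp n i

lemma iteratedDeriv_eventuallyEq {p : PolyVec d} {z : ℝ → Fin d → ℝ} {a : ℝ}
    (hz : ∀ᶠ r in 𝓝 a, HasDerivAt z (evalVec p (z r)) r) (n : ℕ) :
    iteratedDeriv n z =ᶠ[𝓝 a] fun r => evalVec (lieIter p n) (z r) := by
  induction n with
  | zero => simp [lieIter, evalVec_X]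
  | succ n ih =>
    rw [iteratedDeriv_succ]
    filter_upwards [ih.deriv, hz] with r h1 h2
    rw [h1]
    exact (hasDerivWithinAt_univ.1 (hasDerivWithinAt_evalVec _ h2.hasDerivWithinAt)).deriv

/-! ### Taylor's inequality -/

lemma hasDerivWithinAt_Ici_of_Icc {E : Type*} [NormedAddCommGroup E] [NormedSpace ℝ E]
    {f : ℝ → E} {f' : E} {a b s : ℝ}
    (hf : HasDerivWithinAt f f' (Icc a b) s) (hs : s ∈ Ico a b) : HasDerivWithinAt f f' (Ici s) s :=
  hf.mono_of_mem_nhdsWithin (Icc_mem_nhdsGE_of_mem hs)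

/-- Taylor's inequality for a vector-valued function whose successive derivatives on `[0, b]`
are `F 0, F 1, …`, with the sharp factor `1 / n!`. -/
lemma norm_sub_taylor_le {E : Type*} [NormedAddCommGroup E] [NormedSpace ℝ E]
    {F : ℕ → ℝ → E} {b C : ℝ} (n : ℕ)
    (hF : ∀ j, ∀ s ∈ Icc 0 b, HasDerivWithinAt (F j) (F (j + 1) s) (Icc 0 b) s)
    (hC : ∀ s ∈ Icc 0 b, ‖F n s‖ ≤ C) :
    ∀ s ∈ Icc 0 b,
      ‖F 0 s - ∑ j ∈ Finset.range n, (s ^ j / (j.factorial : ℝ)) • F j 0‖ ≤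
        C * s ^ n / n.factorial := by
  induction n generalizing F with
  | zero => simpa using hC
  | succ n ih =>
    have ih' := ih (F := fun j => F (j + 1)) (fun j => hF (j + 1)) hC
    have hpow : ∀ (j : ℕ) (s : ℝ), HasDerivAt (fun s : ℝ => s ^ (j + 1) / ((j + 1).factorial : ℝ))
        (s ^ j / (j.factorial : ℝ)) s := fun j s => by
      convert! (hasDerivAt_pow (j + 1) s).div_const ((j + 1).factorial : ℝ) using 1
      rw [Nat.factorial_succ]
      push_cast
      field_simp
    have hder : ∀ s ∈ Icc 0 b, HasDerivWithinAt
        (fun s => F 0 s - ∑ j ∈ Finset.range (n + 1), (s ^ j / (j.factorial : ℝ)) • F j 0)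
        (F 1 s - ∑ j ∈ Finset.range n, (s ^ j / (j.factorial : ℝ)) • F (j + 1) 0)
        (Icc 0 b) s := fun s hs => by
      refine (hF 0 s hs).fun_sub (HasDerivAt.hasDerivWithinAt ?_)
      simp only [Finset.sum_range_succ' _ n]
      simpa using (HasDerivAt.fun_sum fun j (_ : j ∈ Finset.range n) =>
        (hpow j s).smul_const (F (j + 1) 0)).add_const (F 0 0)
    refine image_norm_le_of_norm_deriv_right_le_deriv_boundary
      (fun s hs => (hder s hs).continuousWithinAt)
      (fun s hs => hasDerivWithinAt_Ici_of_Icc (hder s (Ico_subset_Icc_self hs)) hs) ?_ (fun s => ?_)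
      (fun s hs => ih' s (Ico_subset_Icc_self hs))
    · simp [Finset.sum_range_succ']
    · simpa [mul_div_assoc] using (hpow n s).const_mul C

/-! ### Solutions during one time step -/

lemma one_add_inv_pow_le {k : ℕ} (hk : 2 ≤ k) : (1 + 1 / (k : ℝ)) ^ k ≤ 3 := by
  have hk0 : (0 : ℝ) < k := by positivity
  calc (1 + 1 / (k : ℝ)) ^ k ≤ Real.exp (1 / k) ^ k := by
        gcongr
        linarith [Real.add_one_le_exp (1 / (k : ℝ))]
    _ = Real.exp 1 := by rw [← Real.exp_nat_mul]; congr 1; field_simp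
    _ ≤ 3 := by linarith [Real.exp_one_lt_d9]

lemma one_add_inv_pow_le' {k : ℕ} (hk : 2 ≤ k) :
    (1 + 1 / (k : ℝ)) ^ k ≤ 3 * (k + 1) / 4 := by
  rcases hk.eq_or_lt with rfl | h
  · norm_num
  · have : (3 : ℝ) ≤ k := by exact_mod_cast h
    linarith [one_add_inv_pow_le hk]

section Step

variable {p : PolyVec d} {k : ℕ} {m h : ℝ}

/-- The displacement over a short time step of length `h` at the maximal speed on the ball of
radius `(1 + 1/k) m`. -/
lemma speed_mul_eq (hk : 2 ≤ k) :
    sigmaVec p * ((1 + 1 / (k : ℝ)) * m) ^ k * h =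
      (1 + 1 / (k : ℝ)) ^ k * (m / k) * (k * sigmaVec p * m ^ (k - 1) * h) := by
  obtain ⟨a, rfl⟩ : ∃ a, k = a + 1 := ⟨k - 1, by omega⟩
  have : ((a + 1 : ℕ) : ℝ) ≠ 0 := by positivity
  rw [mul_pow, pow_succ m, Nat.add_sub_cancel]
  field_simp

lemma speed_mul_lt (hk : 2 ≤ k) (hm : 1 ≤ m)
    (hβ : k * sigmaVec p * m ^ (k - 1) * h < 1 / (k + 1)) :
    sigmaVec p * ((1 + 1 / (k : ℝ)) * m) ^ k * h < 3 / (4 * k) * m := by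
  have hk0 : (0 : ℝ) < k := by positivity
  rw [speed_mul_eq hk]
  calc _ < (1 + 1 / (k : ℝ)) ^ k * (m / k) * (1 / (k + 1)) := by gcongr
    _ ≤ (3 * (k + 1) / 4) * (m / k) * (1 / (k + 1)) := by
        gcongr
        exact one_add_inv_pow_le' hk
    _ = _ := by field_simp

lemma speed_mul_le (hk : 2 ≤ k) (hm : 1 ≤ m)
    (hβ : k * sigmaVec p * m ^ (k - 1) * h < 1 / (k + 1)) :
    sigmaVec p * ((1 + 1 / (k : ℝ)) * m) ^ k * h ≤ 3 / (k * (k + 1)) * m := by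
  have hk0 : (0 : ℝ) < k := by positivity
  rw [speed_mul_eq hk]
  calc _ ≤ (1 + 1 / (k : ℝ)) ^ k * (m / k) * (1 / (k + 1)) := by gcongr
    _ ≤ 3 * (m / k) * (1 / (k + 1)) := by
        gcongr
        exact one_add_inv_pow_le hk
    _ = _ := by field_simp

/-- A solution that starts in the ball of radius `m + 1/(4k)` stays, during a time step with
`k Σp m^(k-1) h < 1/(k+1)`, in the ball of radius `(1 + 1/k) m`: there its speed is too small for
it to get out. -/
lemma norm_solution_le {a : ℝ} {y : ℝ → Fin d → ℝ} (hk : 2 ≤ k) (hpk : degVec p ≤ k)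
    (hm : 1 ≤ m) (hh : 0 < h) (hβ : k * sigmaVec p * m ^ (k - 1) * h < 1 / (k + 1))
    (hy : ∀ s ∈ Icc a (a + h), HasDerivWithinAt y (evalVec p (y s)) (Icc a (a + h)) s)
    (hya : ‖y a‖ ≤ m + 1 / (4 * k)) :
    ∀ s ∈ Icc a (a + h), ‖y s‖ ≤ (1 + 1 / (k : ℝ)) * m := by
  have hk0 : (0 : ℝ) < k := by positivity
  -- the fence rises linearly, by `3 m / (4 k)` up to the end of the step
  have hB : ∀ s ∈ Icc a (a + h),
      m + 1 / (4 * k) + 3 / (4 * k) * m / h * (s - a) ≤ (1 + 1 / (k : ℝ)) * m := by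
    intro s hs
    calc _ ≤ m + 1 / (4 * k) * m + 3 / (4 * k) * m / h * h := by
          gcongr
          · exact le_mul_of_one_le_right (by positivity) hm
          · linarith [hs.2]
      _ = _ := by field_simp; ring
  intro s hs
  refine le_trans (image_norm_le_of_norm_deriv_right_lt_deriv_boundary
    (B := fun s => m + 1 / (4 * k) + 3 / (4 * k) * m / h * (s - a))
    (B' := fun _ => 3 / (4 * k) * m / h)
    (fun s hs => (hy s hs).continuousWithinAt)
    (fun s hs => hasDerivWithinAt_Ici_of_Icc (hy s (Ico_subset_Icc_self hs)) hs) (by simpa using hya)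
    (fun s => ?_) (fun s hs hsB => ?_) hs) (hB s hs)
  · simpa using (((hasDerivAt_id s).sub_const a).const_mul (3 / (4 * k) * m / h)).const_add
      (m + 1 / (4 * k))
  · have hsR := hsB.trans_le (hB s (Ico_subset_Icc_self hs))
    rw [lt_div_iff₀ hh]
    refine lt_of_le_of_lt ?_ (speed_mul_lt hk hm hβ)
    gcongr
    refine norm_evalVec_le hpk ?_ hsR
    nlinarith [show 0 < 1 / (k : ℝ) by positivity]

/-- Local existence with a guaranteed interval. It is two-sided, because the Taylor subroutine is
specified by solutions on a neighbourhood of `0`. -/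
lemma exists_solution {x : Fin d → ℝ} (hk : 2 ≤ k) (hpk : degVec p ≤ k) (hm : 1 ≤ m)
    (hh : 0 < h) (hβ : k * sigmaVec p * m ^ (k - 1) * h < 1 / (k + 1)) (hx : ‖x‖ ≤ m) :
    ∃ z : ℝ → Fin d → ℝ, z 0 = x ∧
      ∀ s ∈ Icc (-h) h, HasDerivWithinAt z (evalVec p (z s)) (Icc (-h) h) s := by
  have hk0 : (0 : ℝ) < k := by positivity
  have hσ := sigmaVec_nonneg p
  have hR : 1 ≤ (1 + 1 / (k : ℝ)) * m := by nlinarith [show 0 < 1 / (k : ℝ) by positivity]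
  have hball : ∀ w ∈ Metric.closedBall x (m / k), ‖w‖ ≤ (1 + 1 / (k : ℝ)) * m := fun w hw => by
    have := norm_le_norm_add_norm_sub x w
    rw [mem_closedBall_iff_norm'] at hw
    calc ‖w‖ ≤ m + m / k := by linarith
      _ = _ := by ring
  have hPL : IsPicardLindelof (fun _ => evalVec p) (tmin := -h) (tmax := h)
      ⟨0, by constructor <;> linarith⟩ x (m / k).toNNReal 0
      (sigmaVec p * ((1 + 1 / (k : ℝ)) * m) ^ k).toNNReal
      (k * sigmaVec p * ((1 + 1 / (k : ℝ)) * m) ^ (k - 1)).toNNReal := by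
    have hr : ((m / k).toNNReal : ℝ) = m / k := Real.coe_toNNReal _ (by positivity)
    refine ⟨fun _ _ => ?_, fun _ _ => continuousOn_const, fun _ _ w hw => ?_, ?_⟩
    · rw [hr]
      refine LipschitzOnWith.of_dist_le_mul fun w hw w' hw' => ?_
      rw [Real.coe_toNNReal _ (by positivity), dist_eq_norm, dist_eq_norm]
      exact norm_evalVec_sub_le (by omega) hpk hR (hball _ hw') (hball _ hw)
    · rw [hr] at hw
      rw [Real.coe_toNNReal _ (by positivity)]
      exact norm_evalVec_le hpk hR (hball _ hw)
    · rw [hr, Real.coe_toNNReal _ (by positivity)]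
      simp only [sub_zero, zero_sub, neg_neg, max_self, NNReal.coe_zero]
      refine (speed_mul_lt hk hm hβ).le.trans ?_
      rw [div_mul_eq_mul_div, div_le_div_iff₀ (by positivity) hk0]
      nlinarith
  exact hPL.exists_eq_forall_mem_Icc_hasDerivWithinAt₀

lemma solution_comp_sub {z : ℝ → Fin d → ℝ} (a : ℝ)
    (hz : ∀ s ∈ Icc 0 h, HasDerivWithinAt z (evalVec p (z s)) (Icc 0 h) s) :
    ∀ s ∈ Icc a (a + h), HasDerivWithinAt (fun s => z (s - a)) (evalVec p (z (s - a)))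
      (Icc a (a + h)) s := by
  intro s hs
  have hmaps : MapsTo (fun s => s - a) (Icc a (a + h)) (Icc 0 h) := fun r hr =>
    ⟨by linarith [hr.1], by linarith [hr.2]⟩
  simpa using! (hz (s - a) (hmaps hs)).scomp s
    (((hasDerivAt_id s).sub_const a).hasDerivWithinAt) hmaps

/-- Grönwall's inequality for two solutions during one time step. -/
lemma norm_solution_sub_le {a : ℝ} {y z : ℝ → Fin d → ℝ} (hk : 2 ≤ k) (hpk : degVec p ≤ k)
    (hm : 1 ≤ m) (hh : 0 < h)
    (hy : ∀ s ∈ Icc a (a + h), HasDerivWithinAt y (evalVec p (y s)) (Icc a (a + h)) s)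
    (hz : ∀ s ∈ Icc a (a + h), HasDerivWithinAt z (evalVec p (z s)) (Icc a (a + h)) s)
    (hyR : ∀ s ∈ Icc a (a + h), ‖y s‖ ≤ (1 + 1 / (k : ℝ)) * m)
    (hzR : ∀ s ∈ Icc a (a + h), ‖z s‖ ≤ (1 + 1 / (k : ℝ)) * m) :
    ‖z (a + h) - y (a + h)‖ ≤
      ‖z a - y a‖ * Real.exp (3 * (k * sigmaVec p * m ^ (k - 1) * h)) := by
  have hk0 : (0 : ℝ) < k := by positivity
  have hσ := sigmaVec_nonneg p
  have hR : 1 ≤ (1 + 1 / (k : ℝ)) * m := by nlinarith [show 0 < 1 / (k : ℝ) by positivity]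
  have hL : LipschitzOnWith (k * sigmaVec p * ((1 + 1 / (k : ℝ)) * m) ^ (k - 1)).toNNReal
      (evalVec p) (Metric.closedBall 0 ((1 + 1 / (k : ℝ)) * m)) := by
    refine LipschitzOnWith.of_dist_le_mul fun w hw w' hw' => ?_
    rw [mem_closedBall_zero_iff] at hw hw'
    rw [Real.coe_toNNReal _ (by positivity), dist_eq_norm, dist_eq_norm]
    exact norm_evalVec_sub_le (by omega) hpk hR hw' hw
  have hG := dist_le_of_trajectories_ODE_of_mem (v := fun _ => evalVec p)
    (s := fun _ => Metric.closedBall 0 ((1 + 1 / (k : ℝ)) * m)) (fun _ _ => hL)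
    (fun s hs => (hz s hs).continuousWithinAt)
    (fun s hs => hasDerivWithinAt_Ici_of_Icc (hz s (Ico_subset_Icc_self hs)) hs)
    (fun s hs => mem_closedBall_zero_iff.2 (hzR s (Ico_subset_Icc_self hs)))
    (fun s hs => (hy s hs).continuousWithinAt)
    (fun s hs => hasDerivWithinAt_Ici_of_Icc (hy s (Ico_subset_Icc_self hs)) hs)
    (fun s hs => mem_closedBall_zero_iff.2 (hyR s (Ico_subset_Icc_self hs))) le_rfl
    (a + h) (right_mem_Icc.2 (by linarith))
  rw [Real.coe_toNNReal _ (by positivity), dist_eq_norm, dist_eq_norm] at hG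
  refine hG.trans ?_
  gcongr _ * Real.exp ?_
  have hc : (1 + 1 / (k : ℝ)) ^ (k - 1) ≤ 3 :=
    (pow_le_pow_right₀ (le_add_of_nonneg_right (by positivity)) (Nat.sub_le k 1)).trans
      (one_add_inv_pow_le hk)
  calc _ = (1 + 1 / (k : ℝ)) ^ (k - 1) * (k * sigmaVec p * m ^ (k - 1) * h) := by
        rw [mul_pow, add_sub_cancel_left]; ring
    _ ≤ _ := by gcongr

/-- During a time step the remainder of the Taylor series is at most that of a geometric series
of ratio `1/2`. -/
lemma norm_sub_taylorSum_le {z : ℝ → Fin d → ℝ} (hk : 2 ≤ k) (hpk : degVec p ≤ k) (hm : 1 ≤ m)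
    (hh : 0 < h) (hβ : k * sigmaVec p * m ^ (k - 1) * h < 1 / (k + 1))
    (hev : ∀ᶠ r in 𝓝 (0 : ℝ), HasDerivAt z (evalVec p (z r)) r)
    (hz : ∀ s ∈ Icc 0 h, HasDerivWithinAt z (evalVec p (z s)) (Icc 0 h) s)
    (hzR : ∀ s ∈ Icc 0 h, ‖z s‖ ≤ (1 + 1 / (k : ℝ)) * m) (n : ℕ) :
    ‖z h - taylorSum z 0 n h‖ ≤ 2 * m * (1 / 2) ^ n := by
  have hk0 : (0 : ℝ) < k := by positivity
  have hσ := sigmaVec_nonneg p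
  obtain ⟨a, ha, rfl⟩ : ∃ a, 1 ≤ a ∧ k = a + 1 := ⟨k - 1, by omega, by omega⟩
  set R : ℝ := (1 + 1 / ((a + 1 : ℕ) : ℝ)) * m with hRdef
  have hR : 1 ≤ R := by nlinarith [show 0 < 1 / ((a + 1 : ℕ) : ℝ) by positivity]
  have hR2 : R ≤ 2 * m := by
    have : 1 / ((a + 1 : ℕ) : ℝ) ≤ 1 := by
      rw [div_le_one hk0]; push_cast; linarith [show (0 : ℝ) ≤ a by positivity]
    nlinarith
  have hT := norm_sub_taylor_le (F := fun j s => evalVec (lieIter p j) (z s)) n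
    (fun j s hs => hasDerivWithinAt_evalVec _ (hz s hs))
    (fun s hs => norm_evalVec_lieIter_le ha hpk n hR (hzR s hs)) h (right_mem_Icc.2 hh.le)
  have hsum : taylorSum z 0 n h = ∑ j ∈ Finset.range n,
      (h ^ j / (j.factorial : ℝ)) • evalVec (lieIter p j) (z 0) := by
    simp only [taylorSum, sub_zero]
    exact Finset.sum_congr rfl fun j _ => by rw [(iteratedDeriv_eventuallyEq hev j).self_of_nhds]
  have h0 : evalVec (lieIter p 0) (z h) = z h := evalVec_X _
  rw [hsum]
  simp only [h0] at hT
  refine hT.trans ?_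
  -- by `speed_mul_le` with `k = a + 1`; the last inequality is `a² - 2 a + 4 ≥ 0`
  have hratio : a * sigmaVec p * R ^ a * h ≤ 1 / 2 := by
    have h1 : sigmaVec p * R ^ a * h * R ≤ 3 / ((a + 1) * (a + 2)) * m := by
      have := speed_mul_le hk hm hβ
      rw [← hRdef] at this
      push_cast at this
      calc _ = sigmaVec p * R ^ (a + 1) * h := by ring
        _ ≤ _ := this
        _ = _ := by ring
    have h2 : R = (a + 2) / (a + 1) * m := by
      rw [hRdef]; push_cast; field_simp; ring
    have h3 : sigmaVec p * R ^ a * h ≤ 3 / (a + 2) ^ 2 := by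
      refine le_of_mul_le_mul_right (h1.trans_eq ?_) (zero_lt_one.trans_le hR)
      rw [h2]; field_simp
    calc a * sigmaVec p * R ^ a * h = a * (sigmaVec p * R ^ a * h) := by ring
      _ ≤ a * (3 / (a + 2) ^ 2) := by gcongr
      _ ≤ 1 / 2 := by
        rw [← mul_div_assoc, div_le_div_iff₀ (by positivity) (by norm_num)]
        nlinarith [sq_nonneg ((a : ℝ) - 1)]
  calc _ = R * (a * sigmaVec p * R ^ a * h) ^ n := by
        have : (n.factorial : ℝ) ≠ 0 := by positivity
        field_simp
        ring
    _ ≤ 2 * m * (1 / 2) ^ n := by gcongr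

/-- The error made by one time step of the algorithm: the propagated error, the remainder of the
Taylor series and the error of the Taylor subroutine. -/
lemma norm_computeTaylor_sub_le
    {computeTaylor : PolyVec d → (Fin d → ℝ) → ℕ → ℝ → ℝ → (Fin d → ℝ)}
    (hCT : IsComputeTaylor computeTaylor) {a μ : ℝ} {x : Fin d → ℝ} {y : ℝ → Fin d → ℝ}
    (hk : 2 ≤ k) (hpk : degVec p ≤ k) (hm : 1 ≤ m)
    (hh : 0 < h) (hβ : k * sigmaVec p * m ^ (k - 1) * h < 1 / (k + 1))
    (hy : ∀ s ∈ Icc a (a + h), HasDerivWithinAt y (evalVec p (y s)) (Icc a (a + h)) s)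
    (hx : ‖x‖ ≤ m) (hxy : ‖x - y a‖ ≤ 1 / (4 * k)) (hμ : 0 < μ) (hμ1 : μ ≤ 1) (n : ℕ) :
    ‖computeTaylor p x n μ h - y (a + h)‖ ≤
      ‖x - y a‖ * Real.exp (3 * (k * sigmaVec p * m ^ (k - 1) * h)) +
        2 * m * (1 / 2) ^ n + μ := by
  obtain ⟨z, hz0, hz⟩ := exists_solution hk hpk hm hh hβ hx
  have hev : ∀ᶠ r in 𝓝 (0 : ℝ), HasDerivAt z (evalVec p (z r)) r := by
    filter_upwards [Ioo_mem_nhds (neg_lt_zero.2 hh) hh] with r hr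
    exact (hz r (Ioo_subset_Icc_self hr)).hasDerivAt (Icc_mem_nhds hr.1 hr.2)
  have hz' : ∀ s ∈ Icc 0 h, HasDerivWithinAt z (evalVec p (z s)) (Icc 0 h) s := fun s hs =>
    (hz s ⟨by linarith [hs.1], hs.2⟩).mono (Icc_subset_Icc_left (by linarith))
  have hpos : (0 : ℝ) ≤ 1 / (4 * k) := by positivity
  have hyR := norm_solution_le hk hpk hm hh hβ hy (by
    have := norm_le_norm_add_norm_sub x (y a)
    linarith)
  have hzR := norm_solution_le (a := 0) hk hpk hm hh hβ (by simpa using hz') (by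
    rw [hz0]; linarith)
  rw [zero_add] at hzR
  have h1 := hCT p x n μ h hμ hμ1 z hz0 hev
  have h2 := norm_sub_taylorSum_le hk hpk hm hh hβ hev hz' hzR n
  have h3 := norm_solution_sub_le (z := fun s => z (s - a)) hk hpk hm hh hy
    (solution_comp_sub a hz') hyR
    fun s hs => hzR _ ⟨by linarith [hs.1], by linarith [hs.2]⟩
  simp only [add_sub_cancel_left, sub_self, hz0] at h3
  have h4 := norm_sub_le_norm_sub_add_norm_sub (computeTaylor p x n μ h) (taylorSum z 0 n h) (z h)
  have h5 := norm_sub_le_norm_sub_add_norm_sub (computeTaylor p x n μ h) (z h) (y (a + h))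
  rw [norm_sub_rev (taylorSum z 0 n h)] at h4
  linarith

/-- On one time step the norm of the solution cannot drop so much that the integral falls below
half of `k Σp m^(k-1) h`. -/
lemma le_two_mul_integral {a e : ℝ} {x : Fin d → ℝ} {y : ℝ → Fin d → ℝ}
    (hk : 2 ≤ k) (hpk : degVec p ≤ k) (hm : m = max 1 ‖x‖) (hh : 0 < h)
    (hβ : k * sigmaVec p * m ^ (k - 1) * h < 1 / (k + 1))
    (hy : ∀ s ∈ Icc a (a + h), HasDerivWithinAt y (evalVec p (y s)) (Icc a (a + h)) s)
    (hxy : ‖x - y a‖ ≤ e) (he : e ≤ 1 / (4 * k)) :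
    k * sigmaVec p * m ^ (k - 1) * h ≤ 2 * pivpInt p k e y a (a + h) := by
  have hk0 : (0 : ℝ) < k := by positivity
  have hk2 : (2 : ℝ) ≤ k := by exact_mod_cast hk
  have hσ := sigmaVec_nonneg p
  have hm1 : 1 ≤ m := hm ▸ le_max_left _ _
  have hxm : ‖x‖ ≤ m := hm ▸ le_max_right _ _
  have hR : 1 ≤ (1 + 1 / (k : ℝ)) * m := by nlinarith [show 0 < 1 / (k : ℝ) by positivity]
  have hya := norm_le_norm_add_norm_sub x (y a)
  have hyR := norm_solution_le hk hpk hm1 hh hβ hy (by linarith)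
  have hcont : ContinuousOn (fun u => (k : ℝ) * sigmaVec p * max 1 (e + ‖y u‖) ^ (k - 1))
      (Icc a (a + h)) := by
    have : ContinuousOn y (Icc a (a + h)) := fun s hs => (hy s hs).continuousWithinAt
    fun_prop
  -- the displacement is at most `3 m / (k (k + 1))`
  have hdisp : ∀ s ∈ Icc a (a + h), ‖y s - y a‖ ≤ 3 / (k * (k + 1)) * m := fun s hs => by
    refine (norm_image_sub_le_of_norm_deriv_right_le_segment
      (fun s hs => (hy s hs).continuousWithinAt)
      (fun s hs => hasDerivWithinAt_Ici_of_Icc (hy s (Ico_subset_Icc_self hs)) hs)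
      (fun s hs => norm_evalVec_le hpk hR (hyR s (Ico_subset_Icc_self hs))) s hs).trans ?_
    refine le_trans ?_ (speed_mul_le hk hm1 hβ)
    gcongr
    linarith [hs.2]
  have hlow : ∀ s ∈ Icc a (a + h), (1 + -(3 / (k * (k + 1)))) * m ≤ max 1 (e + ‖y s‖) := by
    intro s hs
    have hθ : 0 ≤ 3 / ((k : ℝ) * (k + 1)) := by positivity
    rcases max_choice 1 ‖x‖ with h1 | h1
    · refine le_max_of_le_left ?_
      rw [hm, h1]
      linarith
    · refine le_max_of_le_right ?_
      have h2 := hdisp s hs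
      have h3 := norm_le_norm_add_norm_sub (y s) (y a)
      have h4 := norm_le_norm_add_norm_sub (y a) x
      rw [← hm] at h1
      rw [norm_sub_rev] at h3 h4
      rw [norm_sub_rev] at h2
      linarith
  have hθ1 : 3 / ((k : ℝ) * (k + 1)) ≤ 1 / 2 := by
    rw [div_le_div_iff₀ (by positivity) (by norm_num)]
    nlinarith
  -- Bernoulli's inequality; the final estimate is `(k - 2) (k - 3) ≥ 0`
  have hbern : 1 / 2 ≤ (1 + -(3 / ((k : ℝ) * (k + 1)))) ^ (k - 1) := by
    refine le_trans ?_ (one_add_mul_le_pow (by linarith) (k - 1))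
    rw [Nat.cast_sub (by omega), Nat.cast_one]
    have : 0 ≤ ((k : ℝ) - 2) * (k - 3) := by
      rcases hk.eq_or_lt with rfl | h3
      · norm_num
      · have : (3 : ℝ) ≤ k := by exact_mod_cast h3
        exact mul_nonneg (by linarith) (by linarith)
    have : ((k : ℝ) - 1) * (3 / (k * (k + 1))) ≤ 1 / 2 := by
      rw [← mul_div_assoc, div_le_div_iff₀ (by positivity) (by norm_num)]
      nlinarith
    linarith
  have hint : ∫ _ in a..(a + h), (k : ℝ) * sigmaVec p * m ^ (k - 1) / 2 ≤
      pivpInt p k e y a (a + h) := by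
    refine intervalIntegral.integral_mono_on (by linarith) intervalIntegrable_const
      (hcont.intervalIntegrable_of_Icc (by linarith)) fun s hs => ?_
    calc (k : ℝ) * sigmaVec p * m ^ (k - 1) / 2 = k * sigmaVec p * (1 / 2 * m ^ (k - 1)) := by ring
      _ ≤ k * sigmaVec p * ((1 + -(3 / ((k : ℝ) * (k + 1)))) ^ (k - 1) * m ^ (k - 1)) := by gcongr
      _ ≤ _ := by
        rw [← mul_pow]
        gcongr
        · exact mul_nonneg (by linarith) (by linarith)
        · exact hlow s hs
  rw [intervalIntegral.integral_const, smul_eq_mul] at hint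
  linarith

end Step

end

section

open Set

/-! ### The parameters of the algorithm -/

section Parameters

lemma two_le_algK (p : PolyVec d) : 2 ≤ algK p := le_max_left _ _

lemma degVec_le_algK (p : PolyVec d) : degVec p ≤ algK p := le_max_right _ _

lemma algK_pos (p : PolyVec d) : (0 : ℝ) < algK p :=
  Nat.cast_pos.2 (zero_lt_two.trans_le (two_le_algK p))

lemma algEps_pos (p : PolyVec d) {ε : ℝ} (hε : 0 < ε) : 0 < algEps p ε := by
  have := algK_pos p
  exact lt_min hε (by positivity)

lemma algEps_mul_le (p : PolyVec d) (ε : ℝ) : 2 * (algK p : ℝ) * algEps p ε ≤ 1 / 2 := by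
  have := algK_pos p
  calc _ ≤ 2 * (algK p : ℝ) * (1 / (4 * algK p)) := by
        gcongr
        exact min_le_right _ _
    _ = 1 / 2 := by field_simp; norm_num

lemma algLam_pos (p : PolyVec d) (ε : ℝ) : 0 < algLam p ε := by
  have h1 := algK_pos p
  have h2 := algEps_mul_le p ε
  rw [algLam, sub_pos, div_lt_one (by linarith)]
  linarith

lemma algLam_lt (p : PolyVec d) {ε : ℝ} (hε : 0 < ε) : algLam p ε < 1 / (algK p + 1) := by
  have h1 := algK_pos p
  have h2 := algEps_mul_le p ε
  have h3 : 0 < 2 * (algK p : ℝ) * algEps p ε := by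
    have := algEps_pos p hε
    positivity
  have h4 : (algK p : ℝ) / (algK p + 1) <
      algK p / (1 - 2 * (algK p : ℝ) * algEps p ε + algK p) :=
    div_lt_div_of_pos_left h1 (by linarith) (by linarith)
  have h5 : 1 / ((algK p : ℝ) + 1) = 1 - algK p / (algK p + 1) := by field_simp; ring
  rw [algLam, h5]
  linarith

lemma half_pow_ceil_le {q : ℝ} (hq : 0 < q) : (1 / 2 : ℝ) ^ ⌈-Real.logb 2 q⌉₊ ≤ q := by
  have h := Nat.le_ceil (-Real.logb 2 q)
  calc (1 / 2 : ℝ) ^ ⌈-Real.logb 2 q⌉₊ = (2 : ℝ) ^ (-(⌈-Real.logb 2 q⌉₊ : ℝ)) := by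
        rw [Real.rpow_neg two_pos.le, Real.rpow_natCast, one_div, inv_pow]
    _ ≤ (2 : ℝ) ^ Real.logb 2 q := by
        gcongr
        · norm_num
        · linarith
    _ = q := Real.rpow_logb two_pos (by norm_num) hq

end Parameters

section TimeStep

variable {p : PolyVec d} {k : ℕ} {lam t u : ℝ} {y : Fin d → ℝ}

lemma timeStep_le : timeStep p k lam t u y ≤ t - u := by
  unfold timeStep
  split_ifs
  exacts [le_rfl, min_le_left _ _]

lemma timeStep_pos (hk : 0 < k) (hlam : 0 < lam) (hu : u < t) : 0 < timeStep p k lam t u y := by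
  have hσ := sigmaVec_nonneg p
  unfold timeStep
  split_ifs with h
  · linarith
  · have : 0 < sigmaVec p := hσ.lt_of_ne' h
    exact lt_min (by linarith) (by positivity)

lemma mul_timeStep_nonneg (hk : 0 < k) (hlam : 0 < lam) (hu : u < t) :
    0 ≤ k * sigmaVec p * max 1 ‖y‖ ^ (k - 1) * timeStep p k lam t u y := by
  have hσ := sigmaVec_nonneg p
  have := timeStep_pos (p := p) (y := y) hk hlam hu
  positivity

lemma mul_timeStep_le (hk : 0 < k) (hlam : 0 < lam) :
    k * sigmaVec p * max 1 ‖y‖ ^ (k - 1) * timeStep p k lam t u y ≤ lam := by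
  have hσ := sigmaVec_nonneg p
  unfold timeStep
  split_ifs with h
  · simp [h, hlam.le]
  · have : 0 < sigmaVec p := hσ.lt_of_ne' h
    rw [← le_div_iff₀' (by positivity)]
    exact min_le_right _ _

/-- Every time step but the last one is as long as the bound `lam` permits. -/
lemma mul_timeStep_eq (hk : 0 < k) (hu : u + timeStep p k lam t u y < t) :
    k * sigmaVec p * max 1 ‖y‖ ^ (k - 1) * timeStep p k lam t u y = lam := by
  have hσ := sigmaVec_nonneg p
  unfold timeStep at hu ⊢
  split_ifs at hu ⊢ with h
  · linarith
  · have : 0 < sigmaVec p := hσ.lt_of_ne' h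
    rw [min_eq_right (by by_contra! h; rw [min_eq_left h.le] at hu; linarith)]
    field_simp

end TimeStep

/-! ### The loop -/

/-- The rule of invariants for the `while` loop: `P` is the invariant and `Q` a property of the
result that `P` ensures at each of the three exits. -/
lemma loop_induction {computeTaylor : PolyVec d → (Fin d → ℝ) → ℕ → ℝ → ℝ → (Fin d → ℝ)}
    {p : PolyVec d} {t : ℝ} {k : ℕ} {lam N η μ I : ℝ}
    (P : ℝ → (Fin d → ℝ) → ℕ → Prop) (Q : Option (Fin d → ℝ) × ℕ → Prop)
    (hexit : ∀ u y i, P u y i → t ≤ u → Q (some y, i))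
    (hcount : ∀ u y i, P u y i → u < t → N ≤ i → Q (none, i))
    (hbudget : ∀ u y i, P u y i → u < t → i < N →
      I < 3 * (i * lam + k * sigmaVec p * max 1 ‖y‖ ^ (k - 1) * timeStep p k lam t u y) →
      Q (none, i + 1))
    (hstep : ∀ u y i, P u y i → u < t → i < N →
      3 * (i * lam + k * sigmaVec p * max 1 ‖y‖ ^ (k - 1) * timeStep p k lam t u y) ≤ I →
      P (u + timeStep p k lam t u y)
        (computeTaylor p y ⌈-Real.logb 2 (η / (6 * N * max 1 ‖y‖))⌉₊ μ (timeStep p k lam t u y))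
        (i + 1))
    (u : ℝ) (y : Fin d → ℝ) (i : ℕ) (hP : P u y i) :
    Q (loop computeTaylor p t k lam N η μ I u y i) := by
  induction hn : ⌈N⌉₊ - i using Nat.strong_induction_on generalizing u y i with
  | _ n ih =>
    rw [loop]
    by_cases hu : u < t
    · rw [if_pos hu]
      by_cases hi : N ≤ i
      · rw [if_pos hi]
        exact hcount u y i hP hu hi
      · rw [if_neg hi]
        have hi' : i < ⌈N⌉₊ := Nat.lt_ceil.2 (not_le.1 hi)
        have hcast : ((i + 1 : ℕ) : ℝ) - 1 = i := by push_cast; ring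
        simp only [hcast]
        split_ifs with hI
        · exact hbudget u y i hP hu (not_le.1 hi) hI
        · exact ih (⌈N⌉₊ - (i + 1)) (by omega) _ _ _
            (hstep u y i hP hu (not_le.1 hi) (not_lt.1 hI)) rfl
    · rw [if_neg hu]
      exact hexit u y i hP (not_lt.1 hu)

/-- The number of steps is bounded without any reference to a solution: as long as the loop goes
on, `3 i λ ≤ I`, hence the test of `i` against `N` never succeeds. -/
theorem solveSteps_le
    (computeTaylor : PolyVec d → (Fin d → ℝ) → ℕ → ℝ → ℝ → (Fin d → ℝ))
    (t₀ : ℝ) (y₀ : Fin d → ℝ) (p : PolyVec d) (t ε : ℝ) {I : ℝ} (hI : 0 < I) :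
    (solveSteps computeTaylor t₀ y₀ p t ε I : ℝ) ≤ 1 + 2 * I / algLam p ε := by
  have hk : 0 < algK p := zero_lt_two.trans_le (two_le_algK p)
  have hlam := algLam_pos p ε
  have key : ∀ i : ℕ, 3 * (i * algLam p ε) ≤ I + 3 * algLam p ε →
      (i : ℝ) ≤ 1 + 2 * I / algLam p ε := fun i hi => by
    rw [← sub_le_iff_le_add', le_div_iff₀ hlam]
    linarith
  refine loop_induction
    (P := fun u _ i => 3 * (i * algLam p ε) ≤ I + 3 * algLam p ε ∧
      (u < t → 3 * (i * algLam p ε) ≤ I))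
    (Q := fun r => (r.2 : ℝ) ≤ 1 + 2 * I / algLam p ε)
    (fun u y i h _ => key i h.1) (fun u y i h _ _ => key i h.1) (fun u y i h hu _ _ => ?_)
    (fun u y i h hu _ hI => ⟨?_, fun hu' => ?_⟩) _ _ _ ?_
  · refine key (i + 1) ?_
    have := h.2 hu
    push_cast
    linarith
  · have := h.2 hu
    push_cast
    linarith
  · rw [mul_timeStep_eq hk hu'] at hI
    push_cast
    linarith
  · norm_num
    exact ⟨by positivity, fun _ => hI.le⟩

/-- The invariant of the correctness proof, with the total `B` of the values `β` so far: it is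
bounded by the budget `I / 3` and by twice the integral up to the present time, and the error
grows by a factor of at most `exp (3 B)`. The parameter `τ` is a bound for the error that one step
adds. -/
structure LoopInvariant (p : PolyVec d) (t₀ t ε I : ℝ) (τ : ℝ) (y : ℝ → Fin d → ℝ)
    (u : ℝ) (x : Fin d → ℝ) (i : ℕ) (B : ℝ) : Prop where
  start_le : t₀ ≤ u
  le_end : u ≤ t
  budget : 3 * B ≤ I
  eq_of_lt : u < t → B = i * algLam p ε
  count : 3 * (i * algLam p ε) ≤ I + 3 * algLam p ε
  integral : B ≤ 2 * pivpInt p (algK p) (algEps p ε) y t₀ u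
  error : ‖x - y u‖ ≤ i * τ * Real.exp (3 * B)

section Invariant

variable {p : PolyVec d} {t₀ t ε I : ℝ} {y₀ : Fin d → ℝ} {y : ℝ → Fin d → ℝ}

lemma pivpInt_integrand_continuousOn (hy : IsSolutionOn p t₀ y₀ t y) (k : ℕ) (e : ℝ) :
    ContinuousOn (fun u => (k : ℝ) * sigmaVec p * max 1 (e + ‖y u‖) ^ (k - 1)) (Icc t₀ t) := by
  have : ContinuousOn y (Icc t₀ t) := fun s hs => (hy.deriv s hs).continuousWithinAt
  fun_prop

lemma pivpInt_add (hy : IsSolutionOn p t₀ y₀ t y) (k : ℕ) (e : ℝ) {u v : ℝ}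
    (hu : t₀ ≤ u) (huv : u ≤ v) (hv : v ≤ t) :
    pivpInt p k e y t₀ v = pivpInt p k e y t₀ u + pivpInt p k e y u v := by
  have hc := pivpInt_integrand_continuousOn hy k e
  exact (intervalIntegral.integral_add_adjacent_intervals
    ((hc.mono (Icc_subset_Icc_right (huv.trans hv))).intervalIntegrable_of_Icc hu)
    ((hc.mono (Icc_subset_Icc hu hv)).intervalIntegrable_of_Icc huv)).symm

lemma pivpInt_nonneg (p : PolyVec d) (k : ℕ) (e : ℝ) (y : ℝ → Fin d → ℝ) {u v : ℝ}
    (huv : u ≤ v) : 0 ≤ pivpInt p k e y u v := by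
  have hσ := sigmaVec_nonneg p
  exact intervalIntegral.integral_nonneg huv fun s _ => by positivity

/-- With the local error bound `2 η / (3 N)` the invariant keeps the error below the reduced
accuracy. -/
lemma LoopInvariant.norm_sub_le {u : ℝ} {x : Fin d → ℝ} {i : ℕ} {B : ℝ} (hε : 0 < ε)
    (hI : 0 < I)
    (h : LoopInvariant p t₀ t ε I
      (2 * (algEps p ε * Real.exp (-I) / (3 * (1 + 2 * I / algLam p ε)))) y u x i B) :
    ‖x - y u‖ ≤ algEps p ε := by
  have hlam := algLam_pos p ε
  have hε' := algEps_pos p hε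
  set N : ℝ := 1 + 2 * I / algLam p ε with hN
  have hN0 : 0 < N := by positivity
  have hiN : (i : ℝ) ≤ N := by
    rw [hN, ← sub_le_iff_le_add', le_div_iff₀ hlam]
    linarith [h.count]
  calc ‖x - y u‖ ≤ _ := h.error
    _ ≤ N * (2 * (algEps p ε * Real.exp (-I) / (3 * N))) * Real.exp I := by
        gcongr
        exact h.budget
    _ = 2 / 3 * algEps p ε := by
        rw [Real.exp_neg]
        field_simp
    _ ≤ algEps p ε := by linarith

/-- During a step that starts from an accurate approximation, the value `β` is at most twice the
integral over the step. -/
lemma mul_timeStep_le_integral (hε : 0 < ε) (hy : IsSolutionOn p t₀ y₀ t y) {u : ℝ}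
    {x : Fin d → ℝ} (hu : t₀ ≤ u) (hut : u < t) (hx : ‖x - y u‖ ≤ algEps p ε) :
    algK p * sigmaVec p * max 1 ‖x‖ ^ (algK p - 1) * timeStep p (algK p) (algLam p ε) t u x ≤
      2 * pivpInt p (algK p) (algEps p ε) y u (u + timeStep p (algK p) (algLam p ε) t u x) := by
  have hk : 0 < algK p := zero_lt_two.trans_le (two_le_algK p)
  have hle := timeStep_le (p := p) (k := algK p) (lam := algLam p ε) (t := t) (u := u) (y := x)
  have hsub : Icc u (u + timeStep p (algK p) (algLam p ε) t u x) ⊆ Icc t₀ t :=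
    Icc_subset_Icc hu (by linarith)
  exact le_two_mul_integral (two_le_algK p) (degVec_le_algK p) rfl
    (timeStep_pos hk (algLam_pos p ε) hut)
    ((mul_timeStep_le hk (algLam_pos p ε)).trans_lt (algLam_lt p hε))
    (fun s hs => (hy.deriv s (hsub hs)).mono hsub) hx (min_le_right _ _)

lemma LoopInvariant.step {computeTaylor : PolyVec d → (Fin d → ℝ) → ℕ → ℝ → ℝ → (Fin d → ℝ)}
    (hCT : IsComputeTaylor computeTaylor) (hε : 0 < ε) (hI : 0 < I)
    (hy : IsSolutionOn p t₀ y₀ t y) {N η δ : ℝ} (hN : N = 1 + 2 * I / algLam p ε)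
    (hη : η = algEps p ε * Real.exp (-I)) {u : ℝ} {x : Fin d → ℝ} {i : ℕ} {B : ℝ}
    (h : LoopInvariant p t₀ t ε I (2 * (η / (3 * N))) y u x i B) (hu : u < t)
    (hδ : δ = timeStep p (algK p) (algLam p ε) t u x)
    (hbudget : 3 * (i * algLam p ε +
      algK p * sigmaVec p * max 1 ‖x‖ ^ (algK p - 1) * δ) ≤ I) :
    LoopInvariant p t₀ t ε I (2 * (η / (3 * N))) y (u + δ)
      (computeTaylor p x ⌈-Real.logb 2 (η / (6 * N * max 1 ‖x‖))⌉₊ (η / (3 * N)) δ) (i + 1)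
      (B + algK p * sigmaVec p * max 1 ‖x‖ ^ (algK p - 1) * δ) := by
  have hk : 0 < algK p := zero_lt_two.trans_le (two_le_algK p)
  have hk1 : (1 : ℝ) ≤ algK p := by exact_mod_cast hk
  have hlam := algLam_pos p ε
  have hε' := algEps_pos p hε
  have hxε : ‖x - y u‖ ≤ algEps p ε := by
    refine LoopInvariant.norm_sub_le (t₀ := t₀) (t := t) (i := i) (B := B) hε hI ?_
    rw [← hN, ← hη]
    exact h
  have hδ0 : 0 < δ := hδ ▸ timeStep_pos hk hlam hu
  have hδt : δ ≤ t - u := hδ ▸ timeStep_le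
  have hβ := hδ ▸ mul_timeStep_nonneg (p := p) (y := x) hk hlam hu
  have hβlt := hδ ▸ (mul_timeStep_le (p := p) (t := t) (u := u) (y := x) hk hlam).trans_lt
    (algLam_lt p hε)
  have hB := h.eq_of_lt hu
  have hN1 : 1 ≤ N := by
    rw [hN]
    exact le_add_of_nonneg_right (by positivity)
  have hη0 : 0 < η := by rw [hη]; positivity
  have hη1 : η ≤ 1 := by
    have h1 : algEps p ε ≤ 1 := by nlinarith [algEps_mul_le p ε]
    have h2 : Real.exp (-I) ≤ 1 := Real.exp_le_one_iff.2 (by linarith)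
    rw [hη]
    exact mul_le_one₀ h1 (Real.exp_pos _).le h2
  have hμ0 : 0 < η / (3 * N) := by positivity
  have hμ1 : η / (3 * N) ≤ 1 := (div_le_one (by positivity)).2 (by linarith)
  have hsub : Icc u (u + δ) ⊆ Icc t₀ t := Icc_subset_Icc h.start_le (by linarith)
  set β := (algK p : ℝ) * sigmaVec p * max 1 ‖x‖ ^ (algK p - 1) * δ with hβdef
  refine ⟨by linarith [h.start_le], by linarith, by rw [hB]; linarith, fun hu' => ?_, ?_, ?_, ?_⟩
  · have : β = algLam p ε := by
      rw [hβdef, hδ]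
      exact mul_timeStep_eq hk (hδ ▸ hu')
    rw [this, hB]
    push_cast
    ring
  · push_cast
    linarith
  · rw [pivpInt_add hy _ _ h.start_le (by linarith) (by linarith : u + δ ≤ t)]
    have := hδ ▸ mul_timeStep_le_integral hε hy h.start_le hu hxε
    linarith [h.integral]
  · set m := max 1 ‖x‖ with hm
    have hm1 : 1 ≤ m := le_max_left _ _
    set n := ⌈-Real.logb 2 (η / (6 * N * m))⌉₊ with hn
    have hT : 2 * m * (1 / 2) ^ n ≤ η / (3 * N) := by
      calc 2 * m * (1 / 2) ^ n ≤ 2 * m * (η / (6 * N * m)) := by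
            gcongr
            exact half_pow_ceil_le (by positivity)
        _ = η / (3 * N) := by field_simp; norm_num
    have hstep := norm_computeTaylor_sub_le hCT (two_le_algK p) (degVec_le_algK p) hm1 hδ0 hβlt
      (fun s hs => (hy.deriv s (hsub hs)).mono hsub) (le_max_right 1 ‖x‖)
      (hxε.trans (min_le_right _ _)) hμ0 hμ1 n
    rw [← hβdef] at hstep
    have hB0 : 0 ≤ B := by rw [hB]; positivity
    calc _ ≤ _ := hstep
      _ ≤ i * (2 * (η / (3 * N))) * Real.exp (3 * B) * Real.exp (3 * β) +
          2 * (η / (3 * N)) * 1 := by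
          have : ‖x - y u‖ * Real.exp (3 * β) ≤
              i * (2 * (η / (3 * N))) * Real.exp (3 * B) * Real.exp (3 * β) := by
            gcongr
            exact h.error
          linarith
      _ ≤ i * (2 * (η / (3 * N))) * Real.exp (3 * B) * Real.exp (3 * β) +
          2 * (η / (3 * N)) * (Real.exp (3 * B) * Real.exp (3 * β)) := by
          gcongr
          rw [← Real.exp_add]
          exact Real.one_le_exp (by positivity)
      _ = _ := by
          rw [mul_add, Real.exp_add]
          push_cast
          ring

end Invariant

/-- The algorithm gives up only at the test against `I`. There the sum of the values `β` is at most
twice the integral over the part of `[t₀, t]` covered so far, which excludes this exit if `I` is at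
least six times the whole integral. -/
theorem solvePIVPVariable_correct
    {computeTaylor : PolyVec d → (Fin d → ℝ) → ℕ → ℝ → ℝ → (Fin d → ℝ)}
    (hCT : IsComputeTaylor computeTaylor) {t₀ : ℝ} {y₀ : Fin d → ℝ} {p : PolyVec d} {t ε I : ℝ}
    (hε : 0 < ε) (hI : 0 < I) {y : ℝ → Fin d → ℝ} (ht : t₀ ≤ t) (hy : IsSolutionOn p t₀ y₀ t y) :
    (solvePIVPVariable computeTaylor t₀ y₀ p t ε I = none ∨
      ∃ x, solvePIVPVariable computeTaylor t₀ y₀ p t ε I = some x ∧ ‖x - y t‖ ≤ ε) ∧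
    (6 * pivpInt p (algK p) (algEps p ε) y t₀ t ≤ I →
      solvePIVPVariable computeTaylor t₀ y₀ p t ε I ≠ none) := by
  have hk : 0 < algK p := zero_lt_two.trans_le (two_le_algK p)
  have hlam := algLam_pos p ε
  refine loop_induction
    (P := fun u x i => ∃ B, LoopInvariant p t₀ t ε I
      (2 * (algEps p ε * Real.exp (-I) / (3 * (1 + 2 * I / algLam p ε)))) y u x i B)
    (Q := fun r => (r.1 = none ∨ ∃ x, r.1 = some x ∧ ‖x - y t‖ ≤ ε) ∧
      (6 * pivpInt p (algK p) (algEps p ε) y t₀ t ≤ I → r.1 ≠ none)) ?_ ?_ ?_ ?_ _ _ _ ?_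
  · rintro u x i ⟨B, h⟩ htu
    obtain rfl : u = t := le_antisymm h.le_end htu
    exact ⟨.inr ⟨x, rfl, (h.norm_sub_le hε hI).trans (min_le_left _ _)⟩, fun _ => by simp⟩
  · rintro u x i ⟨B, h⟩ hu hi
    -- the step counter cannot reach its bound, as `3 i λ ≤ I`
    have h1 := h.budget
    rw [h.eq_of_lt hu] at h1
    rw [← le_sub_iff_add_le', div_le_iff₀ hlam] at hi
    linarith
  · rintro u x i ⟨B, h⟩ hu _ hI'
    refine ⟨.inl rfl, fun hint => absurd hI' (not_lt.2 ?_)⟩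
    have h1 := mul_timeStep_le_integral hε hy h.start_le hu (h.norm_sub_le hε hI)
    have h2 := timeStep_pos (p := p) (y := x) hk hlam hu
    have h3 := timeStep_le (p := p) (k := algK p) (lam := algLam p ε) (t := t) (u := u) (y := x)
    set δ := timeStep p (algK p) (algLam p ε) t u x
    have h4 := pivpInt_add hy (algK p) (algEps p ε) h.start_le
      (by linarith : u ≤ u + δ) (by linarith)
    have h5 := pivpInt_add hy (algK p) (algEps p ε) (by linarith [h.start_le] : t₀ ≤ u + δ)
      (by linarith) le_rfl
    have h6 := pivpInt_nonneg p (algK p) (algEps p ε) y (by linarith : u + δ ≤ t)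
    have h7 := h.integral
    rw [h.eq_of_lt hu] at h7
    linarith
  · rintro u x i ⟨B, h⟩ hu _ hI'
    exact ⟨_, h.step hCT hε hI hy rfl rfl hu rfl hI'⟩
  · refine ⟨0, le_rfl, ht, ?_, ?_, ?_, ?_, ?_⟩
    · simpa using hI.le
    · simp
    · simp only [Nat.cast_zero, zero_mul, mul_zero]
      positivity
    · simp [pivpInt]
    · simp [hy.initial]

end

end PIVP

end

theorem mainTheorem2 {d : ℕ}
    (computeTaylor : PIVP.PolyVec d → (Fin d → ℝ) → ℕ → ℝ → ℝ → (Fin d → ℝ))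
    (hCT : PIVP.IsComputeTaylor computeTaylor)
    (t₀ : ℝ) (y₀ : Fin d → ℝ) (p : PIVP.PolyVec d) (t ε I : ℝ)
    (hε : 0 < ε) (hI : 0 < I) :
    (PIVP.solveSteps computeTaylor t₀ y₀ p t ε I : ℝ) ≤ 1 + 2 * I / PIVP.algLam p ε ∧
    ∀ y : ℝ → Fin d → ℝ, t₀ ≤ t → PIVP.IsSolutionOn p t₀ y₀ t y →
      (PIVP.solvePIVPVariable computeTaylor t₀ y₀ p t ε I = none ∨
        ∃ x : Fin d → ℝ, PIVP.solvePIVPVariable computeTaylor t₀ y₀ p t ε I = some x ∧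
          ‖x - y t‖ ≤ ε) ∧
      (6 * PIVP.pivpInt p (PIVP.algK p) (PIVP.algEps p ε) y t₀ t ≤ I →
        PIVP.solvePIVPVariable computeTaylor t₀ y₀ p t ε I ≠ none) :=
  ⟨PIVP.solveSteps_le computeTaylor t₀ y₀ p t ε hI,
    fun _ ht hy => PIVP.solvePIVPVariable_correct hCT hε hI ht hy⟩
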